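/- For an integer $q\ge 3$ let $\lambda_q=2\cos(\pi/q)$, and let $H^q$ be the Hecke group, that is, the subgroup of $\mathrm{PSL}_2(\mathbb Z[\lambda_q])$ generated by $R=\begin{bmatrix}0&-1\\1&0\end{bmatrix}$ and $S=\begin{bmatrix}1&\lambda_q\\0&1\end{bmatrix}$. For $n\ge 1$ let $H^q(n)$ be the normal subgroup of those members of $H^q$ that are congruent to the identity modulo the ideal $(n)$ of $\mathbb Z[\lambda_q]$ (i.e. that are represented by a matrix congruent to $I$ modulo $(n)$). The Hecke map $\mathcal M_q(n)$ is the quotient by $H^q(n)$ of the universal Hecke map, whose darts are the directed edge from $\infty$ to $0$ and its images under $H^q$. Equivalently, it is the regular map $(G,x,y)$ with $G=H^q/H^q(n)$, where $y$ is the class of $S$ and $xy$ is the class of $R$: its vertices are the left cosets of $\langle y\rangle$ in $G$, its edges are the left cosets of $\langle xy\rangle$, and incidence is non-empty intersection. In its underlying graph, two distinct vertices are adjacent if and only if some edge is incident to both. A finite connected regular graph of degree $d$ is called Ramanujan if every eigenvalue $\mu$ of its adjacency matrix whose modulus is not the largest one (that is, with $|\mu|\neq d$) satisfies $|\mu|<2\sqrt{d-1}$.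 **Corollary.** For every prime $p$, the underlying graphs of the Hecke maps $\mathcal M_4(p)$ and $\mathcal M_6(p)$ are Ramanujan graphs of degree $p$. -/

import Mathlib

namespace HeckeMaps

/-! ### Regular maps and their underlying graphs -/

/-- An algebraic orientable regular map `(G, x, y)`: a group generated by `x` and `y` in which
`(x y)² = 1`. Finiteness of `G` is not a field, so that infinite maps are allowed too.
The elements of `G` are the darts. -/
structure RegularMap where
  G : Type
  [group : Group G]
  x : G
  y : G
  generated : Subgroup.closure {x, y} = (⊤ : Subgroup G)
  sq_eq_one : (x * y) ^ 2 = 1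

namespace RegularMap

attribute [instance] RegularMap.group

variable (M : RegularMap)

/-- The vertices are the left cosets of `⟨y⟩`. -/
abbrev Vertex : Type := M.G ⧸ Subgroup.zpowers M.y

/-- The edges are the left cosets of `⟨x y⟩`. -/
abbrev Edge : Type := M.G ⧸ Subgroup.zpowers (M.x * M.y)

/-- A vertex and an edge are incident if the two cosets have a dart in common. -/
def Incident (v : M.Vertex) (e : M.Edge) : Prop :=
  ∃ g : M.G, (g : M.Vertex) = v ∧ (g : M.Edge) = e

/-- The underlying graph: distinct vertices are adjacent if some edge is incident to both. -/
def graph : SimpleGraph M.Vertex where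
  Adj u v := u ≠ v ∧ ∃ e : M.Edge, M.Incident u e ∧ M.Incident v e
  symm := ⟨fun _ _ h => ⟨h.1.symm, h.2.imp fun _ he => he.symm⟩⟩
  loopless := ⟨fun _ h => h.1 rfl⟩

end RegularMap

/-! ### Ramanujan graphs -/

open Classical in
/-- A Ramanujan graph of degree `d`: a finite connected `d`-regular graph in which every eigenvalue
`μ` of the adjacency matrix whose modulus is not the largest one, `d`, has
`|μ| < 2 √(d - 1)`. -/
def IsRamanujan {V : Type*} (Γ : SimpleGraph V) (d : ℕ) : Prop :=
  Γ.Connected ∧ ∃ _ : Fintype V, Γ.IsRegularOfDegree d ∧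
    ∀ μ : ℝ, Module.End.HasEigenvalue (Matrix.toLin' (Γ.adjMatrix ℝ)) μ →
      |μ| ≠ (d : ℝ) → |μ| < 2 * Real.sqrt ((d : ℝ) - 1)

/-! ### Hecke groups and Hecke maps -/

/-- `λ_q = 2 cos (π / q)`. -/
noncomputable def lam (q : ℕ) : ℝ := 2 * Real.cos (Real.pi / q)

/-- The ring `ℤ[λ_q]`. -/
abbrev HeckeRing (q : ℕ) : Type := Algebra.adjoin ℤ ({lam q} : Set ℝ)

/-- `λ_q` as an element of `ℤ[λ_q]`. -/
noncomputable def lamInt (q : ℕ) : HeckeRing q :=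
  ⟨lam q, Algebra.subset_adjoin (Set.mem_singleton _)⟩

/-- `PSL₂(ℤ[λ_q])`. -/
abbrev HeckePSL (q : ℕ) : Type := Matrix.ProjectiveSpecialLinearGroup (Fin 2) (HeckeRing q)

/-- The projection from `SL₂(ℤ[λ_q])` to `PSL₂(ℤ[λ_q])`. -/
noncomputable abbrev toPSL (q : ℕ) : Matrix.SpecialLinearGroup (Fin 2) (HeckeRing q) →* HeckePSL q :=
  QuotientGroup.mk' _

/-- The matrix `R = (0, -1; 1, 0)`. -/
noncomputable def matR (q : ℕ) : Matrix.SpecialLinearGroup (Fin 2) (HeckeRing q) :=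
  ⟨!![0, -1; 1, 0], by simp [Matrix.det_fin_two]⟩

/-- The matrix `S = (1, λ_q; 0, 1)`. -/
noncomputable def matS (q : ℕ) : Matrix.SpecialLinearGroup (Fin 2) (HeckeRing q) :=
  ⟨!![1, lamInt q; 0, 1], by simp [Matrix.det_fin_two]⟩

/-- The generator `R` of the Hecke group. -/
noncomputable def genR (q : ℕ) : HeckePSL q := toPSL q (matR q)

/-- The generator `S` of the Hecke group. -/
noncomputable def genS (q : ℕ) : HeckePSL q := toPSL q (matS q)

/-- The Hecke group `H^q`. -/
noncomputable def heckeGroup (q : ℕ) : Subgroup (HeckePSL q) :=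
  Subgroup.closure {genR q, genS q}

/-- The members of `PSL₂(ℤ[λ_q])` congruent to the identity modulo the ideal `(n)`, that is,
represented by a matrix congruent to the identity entrywise. -/
noncomputable def congruencePSL (q n : ℕ) : Subgroup (HeckePSL q) :=
  (Matrix.SpecialLinearGroup.map (n := Fin 2)
    (Ideal.Quotient.mk (Ideal.span {(n : HeckeRing q)}))).ker.map (toPSL q)

instance (q n : ℕ) : (congruencePSL q n).Normal :=
  Subgroup.Normal.map inferInstance _ (QuotientGroup.mk'_surjective _)

/-- The principal congruence subgroup `H^q(n)` of the Hecke group. -/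
noncomputable abbrev heckeCongruence (q n : ℕ) : Subgroup (heckeGroup q) :=
  (congruencePSL q n).subgroupOf (heckeGroup q)

/-- `R` as a member of `H^q`. -/
noncomputable def heckeR (q : ℕ) : heckeGroup q :=
  ⟨genR q, Subgroup.subset_closure (by simp)⟩

/-- `S` as a member of `H^q`. -/
noncomputable def heckeS (q : ℕ) : heckeGroup q :=
  ⟨genS q, Subgroup.subset_closure (by simp)⟩

theorem genR_sq (q : ℕ) : genR q ^ 2 = 1 := by
  rw [genR, ← map_pow]
  refine (QuotientGroup.eq_one_iff _).2 (Matrix.SpecialLinearGroup.mem_center_iff.2 ⟨-1, ?_, ?_⟩)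
  · simp
  · rw [Matrix.SpecialLinearGroup.coe_pow]
    ext i j
    fin_cases i <;> fin_cases j <;> simp [matR, pow_two]

theorem heckeGroup_generated (q : ℕ) :
    Subgroup.closure {heckeR q, heckeS q} = (⊤ : Subgroup (heckeGroup q)) := by
  have h := Subgroup.closure_closure_coe_preimage (k := ({genR q, genS q} : Set (HeckePSL q)))
  have e : ((Subtype.val : heckeGroup q → HeckePSL q) ⁻¹' {genR q, genS q})
      = {heckeR q, heckeS q} := by
    ext g
    simp [heckeR, heckeS, Subtype.ext_iff]
  rw [← e]
  exact h

/-- The Hecke map `M_q(n)`: the quotient by `H^q(n)` of the universal Hecke map, whose darts are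
the images `γ(∞ → 0)` with `γ` in `H^q`, each dart being identified with `γ`. The dart `γ` starts
at the vertex `γ ∞`, which is the coset `γ ⟨S⟩`, and its reverse is `γ R`; so
`y = S`, `x y = R` and `x = R S⁻¹`, all taken modulo `H^q(n)`. -/
noncomputable def heckeMap (q n : ℕ) : RegularMap where
  G := heckeGroup q ⧸ heckeCongruence q n
  x := ((heckeR q * (heckeS q)⁻¹ : heckeGroup q) : heckeGroup q ⧸ heckeCongruence q n)
  y := ((heckeS q : heckeGroup q) : heckeGroup q ⧸ heckeCongruence q n)
  generated := by
    let π := QuotientGroup.mk' (heckeCongruence q n)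
    change Subgroup.closure {π (heckeR q * (heckeS q)⁻¹), π (heckeS q)} = ⊤
    have h1 : Subgroup.closure {heckeR q * (heckeS q)⁻¹, heckeS q}
        = (⊤ : Subgroup (heckeGroup q)) := by
      rw [← top_le_iff, ← heckeGroup_generated, Subgroup.closure_le]
      have hx : heckeR q * (heckeS q)⁻¹ ∈
          Subgroup.closure {heckeR q * (heckeS q)⁻¹, heckeS q} :=
        Subgroup.subset_closure (by simp)
      have hy : heckeS q ∈ Subgroup.closure {heckeR q * (heckeS q)⁻¹, heckeS q} :=
        Subgroup.subset_closure (by simp)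
      rintro g (rfl | rfl)
      · simpa using mul_mem hx hy
      · exact hy
    rw [← Set.image_pair, ← MonoidHom.map_closure, h1, ← MonoidHom.range_eq_map]
    exact MonoidHom.range_eq_top.2 (QuotientGroup.mk'_surjective _)
  sq_eq_one := by
    rw [← QuotientGroup.mk_mul, ← QuotientGroup.mk_pow, inv_mul_cancel_right]
    have : heckeR q ^ 2 = 1 := Subtype.ext (genR_sq q)
    rw [this, QuotientGroup.mk_one]

end HeckeMaps

/-! A vertex is a coset `γ⟨S⟩` modulo `p`. It is determined by the first column of `γ` up to sign,
and its neighbours are the cosets of `γ S^k R` with `k` modulo `p`. For `q = 4, 6` the number `λ` is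
irrational and `λ² = m` is an integer, so a matrix generated by `R` and `S` has either integers on
the diagonal and multiples of `λ` off it, or the reverse (`hasParity_of_mem`). Modulo `p`, a first
column `(a, cλ)` is thus a vector `(a, c)` of the plane over `𝔽_p`.

Two steps of the walk return to columns of this kind: columns `u`, `w` lead to `(kjm - 1)u + jλw`.
If `p ∤ m`, then `j = 0` gives `-u` for all `p` values of `k`, while the terms with `j ≠ 0` reach
each vector off the line of `u` exactly once (`sum_two_step`). So the square of the adjacency
operator is `g ↦ p g + P - L`, with `P` the sum of `g` over the plane and `L` its sum over the line
of `u`. Averaging over lines and over the plane leaves only the eigenvalues `p²`, `p`, `1`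
(`sq_eq_of_plane_eigenfunction`). If `p ∣ m`, a direct computation leaves `p²` and `0`.

Hence `|μ| ≠ p` forces `μ² ≤ p < 4(p - 1)`. -/

namespace HeckeMaps

/-! ### Adjacency and connectedness in the graph of a regular map. -/

namespace RegularMap

variable (M : RegularMap)

theorem mul_self_eq_one : (M.x * M.y) * (M.x * M.y) = 1 := by
  rw [← pow_two]; exact M.sq_eq_one

theorem incident_iff (g : M.G) (e : M.Edge) :
    M.Incident (g : M.Vertex) e ↔ ∃ k : ℤ, ((g * M.y ^ k : M.G) : M.Edge) = e := by
  constructor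
  · rintro ⟨h, hv, he⟩
    obtain ⟨k, hk⟩ := Subgroup.mem_zpowers_iff.1 (QuotientGroup.eq.1 hv.symm)
    exact ⟨k, by rw [hk, mul_inv_cancel_left, he]⟩
  · rintro ⟨k, he⟩
    refine ⟨g * M.y ^ k, ?_, he⟩
    exact QuotientGroup.mk_mul_of_mem g (Subgroup.zpow_mem_zpowers M.y k)

theorem edge_eq_iff (g h : M.G) :
    (g : M.Edge) = (h : M.Edge) ↔ h = g ∨ h = g * (M.x * M.y) := by
  rw [QuotientGroup.eq]
  constructor
  · intro H
    obtain ⟨k, hk⟩ := Subgroup.mem_zpowers_iff.1 H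
    rcases Int.even_or_odd' k with ⟨j, rfl | rfl⟩
    · left
      rw [zpow_mul, zpow_ofNat, M.sq_eq_one, one_zpow] at hk
      exact (inv_mul_eq_one.1 hk.symm).symm
    · right
      rw [zpow_add, zpow_mul, zpow_ofNat, M.sq_eq_one, one_zpow, one_mul, zpow_one] at hk
      rw [hk, mul_inv_cancel_left]
  · rintro (rfl | rfl)
    · simp
    · simp

/-- The vertices adjacent to `g ⟨y⟩` are the cosets `g y ^ k (x y) ⟨y⟩` other than `g ⟨y⟩`. -/
theorem adj_iff (g : M.G) (v : M.Vertex) :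
    M.graph.Adj (g : M.Vertex) v ↔
      (g : M.Vertex) ≠ v ∧ ∃ k : ℤ, ((g * M.y ^ k * (M.x * M.y) : M.G) : M.Vertex) = v := by
  induction v using QuotientGroup.induction_on with
  | H h =>
  change (g : M.Vertex) ≠ h ∧ _ ↔ _
  refine and_congr_right fun hne => ?_
  simp only [incident_iff]
  constructor
  · rintro ⟨e, ⟨k, hk⟩, ⟨j, hj⟩⟩
    rw [← hj, edge_eq_iff] at hk
    have hh : ((h * M.y ^ j : M.G) : M.Vertex) = h :=
      QuotientGroup.mk_mul_of_mem h (Subgroup.zpow_mem_zpowers M.y j)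
    rcases hk with hk | hk
    · refine absurd ?_ hne
      rw [← hh, hk]
      exact (QuotientGroup.mk_mul_of_mem g (Subgroup.zpow_mem_zpowers M.y k)).symm
    · exact ⟨k, by rw [← hk, hh]⟩
  · rintro ⟨k, hk⟩
    obtain ⟨j, hj⟩ := Subgroup.mem_zpowers_iff.1 (QuotientGroup.eq.1 hk)
    refine ⟨_, ⟨k, rfl⟩, -j, ?_⟩
    symm
    rw [edge_eq_iff]
    right
    rw [zpow_neg, hj]
    group

/-- Right multiplication by `y` fixes the vertex of a dart, and by `x y` it moves to the same or an
adjacent vertex; these two generate the group. -/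
theorem connected : M.graph.Connected := by
  have key : ∀ g : M.G, M.graph.Reachable ((1 : M.G) : M.Vertex) (g : M.Vertex) := by
    have hx : ∀ g : M.G, M.graph.Reachable (g : M.Vertex) ((g * (M.x * M.y) : M.G) : M.Vertex) := by
      intro g
      by_cases h : (g : M.Vertex) = ((g * (M.x * M.y) : M.G) : M.Vertex)
      · rw [← h]
      · exact SimpleGraph.Adj.reachable ((M.adj_iff _ _).2 ⟨h, 0, by simp⟩)
    have hy : ∀ (g : M.G) (k : ℤ), ((g * M.y ^ k : M.G) : M.Vertex) = g := fun g k =>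
      QuotientGroup.mk_mul_of_mem g (Subgroup.zpow_mem_zpowers M.y k)
    have hy1 : ∀ g : M.G, ((g * M.y : M.G) : M.Vertex) = g := fun g => by simp
    have hy2 : ∀ g : M.G, ((g * M.y⁻¹ : M.G) : M.Vertex) = g := fun g => by simp
    intro g
    have hg : g ∈ Subgroup.closure {M.x, M.y} := by rw [M.generated]; trivial
    induction hg using Subgroup.closure_induction_right with
    | one => exact SimpleGraph.Reachable.refl _
    | mul_right a _ z hz ih =>
      rcases hz with rfl | rfl
      · refine ih.trans ?_
        have := hx a
        rwa [← mul_assoc, hy1] at this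
      · rwa [hy1]
    | mul_inv_cancel a _ z hz ih =>
      rcases hz with rfl | rfl
      · refine ih.trans ?_
        -- The step by `x y` from `a x⁻¹` ends at `a y`, which lies in the coset of `a`.
        have h3 := (hx (a * M.x⁻¹)).symm
        rw [← mul_assoc, hy1, inv_mul_cancel_right] at h3
        exact h3
      · rwa [hy2]
  have : Nonempty M.Vertex := ⟨((1 : M.G) : M.Vertex)⟩
  refine ⟨fun u v => ?_⟩
  induction u using QuotientGroup.induction_on with
  | H g =>
  induction v using QuotientGroup.induction_on with
  | H h => exact (key g).symm.trans (key h)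

/-! ### The `p` neighbours of a vertex when `y ^ p = 1`. -/

section Neighbors

variable {M} {p : ℕ} [NeZero p]

/-- The other end of the dart `g y ^ k`. -/
def neighbor (M : RegularMap) (p : ℕ) (g : M.G) (k : ZMod p) : M.Vertex :=
  ((g * M.y ^ k.val * (M.x * M.y) : M.G) : M.Vertex)

/-- The hypothesis excludes multiple edges: two darts `g y^i`, `g y^j` with the same far end put `(x
y) y^(j-i) (x y)` into `⟨y⟩`. -/
theorem neighbor_injective
    (hk : ∀ k : ℤ, (M.x * M.y) * M.y ^ k * (M.x * M.y) ∈ Subgroup.zpowers M.y → (p : ℤ) ∣ k)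
    (g : M.G) : Function.Injective (M.neighbor p g) := by
  intro i j hij
  have h := QuotientGroup.eq.1 hij
  have e : (g * M.y ^ i.val * (M.x * M.y))⁻¹ * (g * M.y ^ j.val * (M.x * M.y))
      = (M.x * M.y) * M.y ^ ((j.val : ℤ) - (i.val : ℤ)) * (M.x * M.y) := by
    have e2 : (M.x * M.y)⁻¹ = M.x * M.y := inv_eq_of_mul_eq_one_right M.mul_self_eq_one
    rw [mul_inv_rev, e2, zpow_sub, zpow_natCast, zpow_natCast,
      ((Commute.refl M.y).pow_pow j.val i.val).inv_right.eq]
    group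
  rw [e] at h
  have := hk _ h
  have := (ZMod.intCast_zmod_eq_zero_iff_dvd _ p).2 this
  push_cast at this
  rw [ZMod.natCast_zmod_val, ZMod.natCast_zmod_val, sub_eq_zero] at this
  exact this.symm

theorem adj_iff_neighbor (hy : M.y ^ p = 1) (hW : M.x * M.y ∉ Subgroup.zpowers M.y)
    (g : M.G) (v : M.Vertex) :
    M.graph.Adj (g : M.Vertex) v ↔ ∃ k : ZMod p, M.neighbor p g k = v := by
  rw [adj_iff]
  constructor
  · rintro ⟨-, k, rfl⟩
    refine ⟨(k : ZMod p), ?_⟩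
    unfold neighbor
    congr 3
    rw [← zpow_natCast, ZMod.val_intCast]
    exact (zpow_eq_zpow_emod' k hy).symm
  · rintro ⟨k, rfl⟩
    refine ⟨fun h => hW ?_, (k.val : ℤ), by rw [zpow_natCast, neighbor]⟩
    have h2 := QuotientGroup.eq.1 h
    rw [mul_assoc, inv_mul_cancel_left] at h2
    exact (Subgroup.mul_mem_cancel_left _
      (Subgroup.pow_mem _ (Subgroup.mem_zpowers M.y) _)).1 h2

open Classical in
theorem neighborFinset_eq [Fintype M.Vertex] (hy : M.y ^ p = 1)
    (hW : M.x * M.y ∉ Subgroup.zpowers M.y) (g : M.G) :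
    M.graph.neighborFinset (g : M.Vertex) = Finset.univ.image (M.neighbor p g) := by
  ext v
  simp [adj_iff_neighbor hy hW]

open Classical in
theorem isRegularOfDegree [Fintype M.Vertex] (hy : M.y ^ p = 1)
    (hW : M.x * M.y ∉ Subgroup.zpowers M.y)
    (hk : ∀ k : ℤ, (M.x * M.y) * M.y ^ k * (M.x * M.y) ∈ Subgroup.zpowers M.y → (p : ℤ) ∣ k) :
    M.graph.IsRegularOfDegree p := by
  intro v
  induction v using QuotientGroup.induction_on with
  | H g =>
  rw [← SimpleGraph.card_neighborFinset_eq_degree, neighborFinset_eq hy hW,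
    Finset.card_image_of_injective _ (neighbor_injective hk g), Finset.card_univ, ZMod.card]

open Classical in
theorem adjMatrix_mulVec_apply [Fintype M.Vertex] (hy : M.y ^ p = 1)
    (hW : M.x * M.y ∉ Subgroup.zpowers M.y)
    (hk : ∀ k : ℤ, (M.x * M.y) * M.y ^ k * (M.x * M.y) ∈ Subgroup.zpowers M.y → (p : ℤ) ∣ k)
    (f : M.Vertex → ℝ) (g : M.G) :
    ((M.graph.adjMatrix ℝ).mulVec f) (g : M.Vertex) = ∑ k : ZMod p, f (M.neighbor p g k) := by
  rw [SimpleGraph.adjMatrix_mulVec_apply, neighborFinset_eq hy hW,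
    Finset.sum_image fun _ _ _ _ h => neighbor_injective hk g h]

end Neighbors

end RegularMap

/-! ### Functions on the plane over a prime field -/

section Plane

variable {p : ℕ} [Fact p.Prime]

/-- Summing the relation over the nonzero vectors of a line gives `c L = L + (p - 1) P`, and over
the plane `c P = p² P`. So `c = p²` unless `P = 0`; then `c = 1` if some line sum is nonzero, and
otherwise `c g = p g`. -/
theorem sq_eq_of_plane_eigenfunction (g : ZMod p → ZMod p → ℝ) (c : ℝ) (g_zero : g 0 0 = 0)
    (h : ∀ s t, (s ≠ 0 ∨ t ≠ 0) →
      c * g s t = p * g s t + (∑ a, ∑ b, g a b) - ∑ r, g (r * s) (r * t))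
    {s₀ t₀ : ZMod p} (hne : g s₀ t₀ ≠ 0) : c = p ^ 2 ∨ c = p ∨ c = 1 := by
  set P := ∑ a, ∑ b, g a b with hP
  let L : ZMod p → ZMod p → ℝ := fun s t => ∑ r, g (r * s) (r * t)
  have hp1 : ((Finset.univ.erase (0 : ZMod p)).card : ℝ) = p - 1 := by
    rw [Finset.card_erase_of_mem (Finset.mem_univ _), Finset.card_univ, ZMod.card,
      Nat.cast_sub (Fact.out : p.Prime).one_le, Nat.cast_one]
  have L_smul : ∀ r s t, r ≠ 0 → L (r * s) (r * t) = L s t := by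
    intro r s t hr
    refine Fintype.sum_equiv (Equiv.mulRight₀ r hr) _ _ fun x => ?_
    simp [mul_assoc]
  have L_erase : ∀ s t, L s t = ∑ r ∈ Finset.univ.erase 0, g (r * s) (r * t) := by
    intro s t
    rw [Finset.sum_erase]
    simpa using g_zero
  have hL : ∀ s t, (s ≠ 0 ∨ t ≠ 0) → c * L s t = L s t + (p - 1) * P := by
    intro s t hst
    have : c * L s t = ∑ r ∈ Finset.univ.erase 0, (p * g (r * s) (r * t) + (P - L s t)) := by
      rw [L_erase, Finset.mul_sum]
      refine Finset.sum_congr rfl fun r hr => ?_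
      have hr0 := Finset.ne_of_mem_erase hr
      rw [h (r * s) (r * t) (by simpa [hr0] using hst), ← L_erase]
      have := L_smul r s t hr0
      simp only [L] at this
      rw [this]
      simp only [L]
      ring
    rw [this, Finset.sum_add_distrib, ← Finset.mul_sum, ← L_erase, Finset.sum_const, nsmul_eq_mul,
      hp1]
    ring
  have hL0 : L 0 0 = 0 := by simp [L, g_zero]
  have hLsum : ∑ a, ∑ b, L a b = (p - 1) * P := by
    have : ∑ a, ∑ b, L a b = ∑ r ∈ Finset.univ.erase 0, ∑ a, ∑ b, g (r * a) (r * b) := by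
      simp only [L_erase]
      exact (Finset.sum_congr rfl fun a _ => Finset.sum_comm).trans Finset.sum_comm
    rw [this, ← hp1, ← nsmul_eq_mul, ← Finset.sum_const]
    refine Finset.sum_congr rfl fun r hr => ?_
    have hr0 := Finset.ne_of_mem_erase hr
    refine Fintype.sum_equiv (Equiv.mulLeft₀ r hr0) _ _ fun a => ?_
    refine Fintype.sum_equiv (Equiv.mulLeft₀ r hr0) _ _ fun b => ?_
    simp
  have hPP : c * P = p ^ 2 * P := by
    -- The relation fails at the origin by exactly `P`, because `g` and `L` vanish there.
    have key : ∀ a b, c * g a b = p * g a b + P - L a b - if a = 0 ∧ b = 0 then P else 0 := by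
      intro a b
      by_cases hab : a = 0 ∧ b = 0
      · obtain ⟨rfl, rfl⟩ := hab
        simp [g_zero, hL0]
      · rw [if_neg hab, sub_zero]
        exact h a b (by tauto)
    have e : ∑ a : ZMod p, ∑ b : ZMod p, (if a = 0 ∧ b = 0 then P else 0) = P := by
      simp only [ite_and]
      simp
    have : c * P = ∑ a, ∑ b, (p * g a b + P - L a b - if a = 0 ∧ b = 0 then P else 0) := by
      rw [hP, Finset.mul_sum]
      refine Finset.sum_congr rfl fun a _ => ?_
      rw [Finset.mul_sum]
      exact Finset.sum_congr rfl fun b _ => key a b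
    simp only [Finset.sum_sub_distrib, Finset.sum_add_distrib, e, hLsum, ← Finset.mul_sum, ← hP]
      at this
    simp only [Finset.sum_const, Finset.card_univ, ZMod.card, nsmul_eq_mul] at this
    rw [this]
    ring
  by_cases hc : c = p ^ 2
  · exact Or.inl hc
  have P0 : P = 0 := by
    have : (c - p ^ 2) * P = 0 := by linear_combination hPP
    exact (mul_eq_zero.1 this).resolve_left (sub_ne_zero.2 hc)
  have hst : s₀ ≠ 0 ∨ t₀ ≠ 0 := by
    by_contra! H
    rw [H.1, H.2] at hne
    exact hne g_zero
  by_cases hL1 : L s₀ t₀ = 0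
  · right; left
    have h1 := h s₀ t₀ hst
    have h2 : ∑ r, g (r * s₀) (r * t₀) = 0 := hL1
    rw [h2, P0] at h1
    exact mul_right_cancel₀ hne (by linear_combination h1)
  · right; right
    have h1 := hL s₀ t₀ hst
    rw [P0] at h1
    exact mul_right_cancel₀ hL1 (by linear_combination h1)

/-- For `j ≠ 0` the coefficient `k j m - 1` runs over the whole field with `k`, so these terms sum
`g` over the plane minus the line of `(s, t)`, in the unimodular basis `(s, t)`, `(m x, y)`. For `j
= 0` the point is always `-(s, t)`. -/
theorem sum_two_step (g : ZMod p → ZMod p → ℝ) (g_neg : ∀ s t, g (-s) (-t) = g s t)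
    {m : ZMod p} (hm : m ≠ 0) {s t x y : ZMod p} (hdet : s * y - m * x * t = 1) :
    ∑ k, ∑ j, g ((k * j * m - 1) * s + j * m * x) ((k * j * m - 1) * t + j * y)
      = p * g s t + (∑ a, ∑ b, g a b) - ∑ r, g (r * s) (r * t) := by
  let φ : ZMod p → ZMod p → ℝ := fun j r => g (r * s + j * m * x) (r * t + j * y)
  have e1 : ∑ a, ∑ b, g a b = ∑ j, ∑ r, φ j r := by
    rw [← Fintype.sum_prod_type', ← Fintype.sum_prod_type']
    symm
    refine Fintype.sum_equiv
      ⟨fun z => (z.2 * s + z.1 * m * x, z.2 * t + z.1 * y),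
        fun w => (s * w.2 - t * w.1, y * w.1 - m * x * w.2), fun z => ?_, fun w => ?_⟩ _ _ fun z => rfl
    · ext
      · simp only
        linear_combination z.1 * hdet
      · simp only
        linear_combination z.2 * hdet
    · ext
      · simp only
        linear_combination w.1 * hdet
      · simp only
        linear_combination w.2 * hdet
  have e2 : ∑ r, g (r * s) (r * t) = ∑ r, φ 0 r := by simp [φ]
  rw [Finset.sum_comm, e1, e2, ← Finset.add_sum_erase _ _ (Finset.mem_univ (0 : ZMod p)),
    ← Finset.add_sum_erase _ (fun j => ∑ r, φ j r) (Finset.mem_univ (0 : ZMod p))]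
  have e3 : ∑ k : ZMod p, g ((k * 0 * m - 1) * s + 0 * m * x) ((k * 0 * m - 1) * t + 0 * y)
      = p * g s t := by
    simp [g_neg]
  have e4 : ∀ j ∈ Finset.univ.erase (0 : ZMod p),
      ∑ k, g ((k * j * m - 1) * s + j * m * x) ((k * j * m - 1) * t + j * y) = ∑ r, φ j r := by
    intro j hj
    have hj0 := Finset.ne_of_mem_erase hj
    refine Fintype.sum_equiv
      ((Equiv.mulRight₀ (j * m) (mul_ne_zero hj0 hm)).trans (Equiv.subRight 1)) _ _ fun k => ?_
    simp [φ, mul_assoc]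
  rw [e3, Finset.sum_congr rfl e4]
  ring

end Plane

theorem abs_lt_two_sqrt_of_sq {p : ℕ} (hp : 2 ≤ p) {μ : ℝ} (hne : |μ| ≠ p)
    (h : μ ^ 2 = p ^ 2 ∨ μ ^ 2 = p ∨ μ ^ 2 = 1 ∨ μ ^ 2 = 0) : |μ| < 2 * Real.sqrt ((p : ℝ) - 1) := by
  have hp' : (2 : ℝ) ≤ p := by exact_mod_cast hp
  have h1 : μ ^ 2 ≠ p ^ 2 := fun H => hne (by
    rw [← Real.sqrt_sq_eq_abs, H, Real.sqrt_sq (by positivity)])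
  refine abs_lt_of_sq_lt_sq ?_ (by positivity)
  -- It remains to compare `μ²` with `4 (p - 1)`, which exceeds `p` as soon as `p ≥ 2`.
  rw [mul_pow, Real.sq_sqrt (by linarith)]
  rcases h with h | h | h | h
  · exact absurd h h1
  all_goals rw [h]; linarith

open Matrix (det_fin_two adjugate_fin_two adjugate_fin_two_of one_fin_two mul_fin_two mul_apply
  one_apply_eq one_apply_ne)
open Matrix.SpecialLinearGroup (coe_mul coe_inv coe_one)

/-! ### Matrices over the residue ring -/

section Residue

variable {Q : Type*} [CommRing Q]

/-- The matrix `(1, x; 0, 1)`. -/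
def upper (x : Q) : Matrix.SpecialLinearGroup (Fin 2) Q := ⟨!![1, x; 0, 1], by simp [det_fin_two]⟩

variable (Q) in
/-- The matrix `(0, -1; 1, 0)`. -/
def weyl : Matrix.SpecialLinearGroup (Fin 2) Q := ⟨!![0, -1; 1, 0], by simp [det_fin_two]⟩

theorem coe_upper (x : Q) : (upper x : Matrix (Fin 2) (Fin 2) Q) = !![1, x; 0, 1] := rfl

theorem coe_weyl : (weyl Q : Matrix (Fin 2) (Fin 2) Q) = !![0, -1; 1, 0] := rfl

theorem upper_pow (x : Q) (n : ℕ) : upper x ^ n = upper (n * x) := by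
  induction n with
  | zero => ext i j; fin_cases i <;> fin_cases j <;> simp [coe_upper]
  | succ n ih =>
    rw [pow_succ, ih]
    ext i j
    fin_cases i <;> fin_cases j <;> simp [coe_upper, coe_mul]
    ring

theorem upper_zpow (x : Q) (n : ℤ) : upper x ^ n = upper (n * x) := by
  have hinv : ∀ y : Q, (upper y)⁻¹ = upper (-y) := by
    intro y
    ext i j
    fin_cases i <;> fin_cases j <;> simp [coe_upper, coe_inv, adjugate_fin_two]
  cases n with
  | ofNat n => simpa using upper_pow x n
  | negSucc n =>
    rw [zpow_negSucc, upper_pow, hinv]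
    congr 1
    push_cast
    ring

variable {p : ℕ} (ι : ZMod p →+* Q) (l : Q)

/-- Matrices of the form `(a, b l; c l, d)` or `(a l, b; c, d l)` with `a`, `b`, `c`, `d` in the
prime field. -/
def HasParity (A : Matrix (Fin 2) (Fin 2) Q) : Prop :=
  (∃ a b c d, A = !![ι a, ι b * l; ι c * l, ι d]) ∨
    ∃ a b c d, A = !![ι a * l, ι b; ι c, ι d * l]

variable {ι l} {m : ZMod p}

theorem hasParity_of_mem (hl : l * l = ι m) {X : Matrix.SpecialLinearGroup (Fin 2) Q}
    (hX : X ∈ Subgroup.closure {weyl Q, upper l}) :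
    HasParity ι l (X : Matrix (Fin 2) (Fin 2) Q) := by
  induction hX using Subgroup.closure_induction with
  | mem X h =>
    rcases h with rfl | rfl
    · exact Or.inr ⟨0, -1, 1, 0, by simp [coe_weyl]⟩
    · exact Or.inl ⟨1, 1, 0, 1, by simp [coe_upper]⟩
  | one => exact Or.inl ⟨1, 0, 0, 1, by simp [one_fin_two]⟩
  | mul X Y _ _ hX hY =>
    rw [coe_mul]
    rcases hX with ⟨a, b, c, d, hX⟩ | ⟨a, b, c, d, hX⟩ <;>
    rcases hY with ⟨a', b', c', d', hY⟩ | ⟨a', b', c', d', hY⟩ <;> rw [hX, hY, mul_fin_two]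
    · refine Or.inl ⟨a * a' + m * b * c', a * b' + b * d', c * a' + d * c', m * c * b' + d * d', ?_⟩
      simp only [map_add, map_mul, ← hl]
      ext i j
      fin_cases i <;> fin_cases j <;> dsimp <;> ring
    · refine Or.inr ⟨a * a' + b * c', a * b' + m * b * d', m * c * a' + d * c', c * b' + d * d', ?_⟩
      simp only [map_add, map_mul, ← hl]
      ext i j
      fin_cases i <;> fin_cases j <;> dsimp <;> ring
    · refine Or.inr ⟨a * a' + b * c', m * a * b' + b * d', c * a' + m * d * c', c * b' + d * d', ?_⟩
      simp only [map_add, map_mul, ← hl]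
      ext i j
      fin_cases i <;> fin_cases j <;> dsimp <;> ring
    · refine Or.inl ⟨m * a * a' + b * c', a * b' + b * d', c * a' + d * c', c * b' + m * d * d', ?_⟩
      simp only [map_add, map_mul, ← hl]
      ext i j
      fin_cases i <;> fin_cases j <;> dsimp <;> ring
  | inv X _ hX =>
    rw [coe_inv]
    rcases hX with ⟨a, b, c, d, hX⟩ | ⟨a, b, c, d, hX⟩ <;> rw [hX, adjugate_fin_two_of]
    · exact Or.inl ⟨d, -b, -c, a, by simp⟩
    · exact Or.inr ⟨d, -b, -c, a, by simp⟩

variable {Γ : Type*} [Group Γ] {β : Γ →* Matrix.SpecialLinearGroup (Fin 2) Q} {r s : Γ}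

theorem natCast_val_eq [NeZero p] (ι : ZMod p →+* Q) (k : ZMod p) : ((k.val : ℕ) : Q) = ι k := by
  rw [← map_natCast ι, ZMod.natCast_zmod_val]

theorem map_two_step [NeZero p] (hr : β r = weyl Q) (hs : β s = upper l) (A : Γ) (k j : ZMod p)
    (i : Fin 2) :
    β (A * s ^ k.val * r * s ^ j.val * r) i 0
      = (ι k * ι j * (l * l) - 1) * β A i 0 + ι j * l * β A i 1 := by
  have hval := natCast_val_eq ι
  simp only [map_mul, map_pow, hr, hs, upper_pow, hval, coe_mul, coe_upper, coe_weyl]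
  simp [mul_apply, Fin.sum_univ_two]
  ring

theorem lower_apply [NeZero p] (hr : β r = weyl Q) (hs : β s = upper l) (A : Γ) (k : ZMod p) :
    β (r * s ^ (-k).val * r⁻¹ * A) 0 0 = β A 0 0 ∧
      β (r * s ^ (-k).val * r⁻¹ * A) 1 0 = β A 1 0 + ι k * l * β A 0 0 := by
  have hval := natCast_val_eq ι
  constructor <;>
  simp [hr, hs, upper_pow, hval, coe_mul, coe_inv, coe_upper, coe_weyl, mul_apply,
    Fin.sum_univ_two, adjugate_fin_two] <;> ring

theorem upper_apply [NeZero p] (hs : β s = upper l) (A : Γ) (k : ZMod p) :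
    β (s ^ k.val * A) 0 0 = β A 0 0 + ι k * l * β A 1 0 ∧ β (s ^ k.val * A) 1 0 = β A 1 0 := by
  have hval := natCast_val_eq ι
  constructor <;>
  simp [hs, upper_pow, hval, coe_mul, coe_upper, mul_apply, Fin.sum_univ_two]

/-- Elementary matrices carry `(1, 0)` to any nonzero `(a, c)`: a lower one makes the second
coordinate `c`, then an upper one with parameter `k` adds `k m c` to the first, which reaches `a`
because `m c ≠ 0`. If `c = 0`, start from `(a, 1)` and clear the second coordinate. -/
theorem exists_col_eq [Fact p.Prime] (hl : l * l = ι m) (hm : m ≠ 0) (hr : β r = weyl Q)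
    (hs : β s = upper l) (a c : ZMod p) (hac : a ≠ 0 ∨ c ≠ 0) :
    ∃ A : Γ, β A 0 0 = ι a ∧ β A 1 0 = ι c * l := by
  have key : ∀ a c : ZMod p, c ≠ 0 → ∃ A : Γ, β A 0 0 = ι a ∧ β A 1 0 = ι c * l := by
    intro a c hc
    refine ⟨s ^ ((a - 1) / (m * c)).val * (r * s ^ (-c).val * r⁻¹ * 1), ?_, ?_⟩
    · rw [(upper_apply (ι := ι) hs _ _).1, (lower_apply (ι := ι) hr hs _ _).1,
        (lower_apply (ι := ι) hr hs _ _).2]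
      have e : (a - 1) / (m * c) * (m * c) = a - 1 := div_mul_cancel₀ _ (mul_ne_zero hm hc)
      have e2 := congrArg ι e
      simp only [map_mul, map_sub, map_one] at e2 ⊢
      simp only [coe_one, one_apply_eq, one_apply_ne (one_ne_zero : (1 : Fin 2) ≠ 0)]
      linear_combination e2 + ι ((a - 1) / (m * c)) * ι c * hl
    · rw [(upper_apply (ι := ι) hs _ _).2, (lower_apply (ι := ι) hr hs _ _).2]
      simp
  by_cases hc : c = 0
  · have ha : a ≠ 0 := hac.resolve_right (not_not.2 hc)
    obtain ⟨A, h0, h1⟩ := key a 1 one_ne_zero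
    refine ⟨r * s ^ (-(-1 / a)).val * r⁻¹ * A, ?_, ?_⟩
    · rw [(lower_apply (ι := ι) hr hs _ _).1, h0]
    · rw [(lower_apply (ι := ι) hr hs _ _).2, h0, h1, hc]
      have e2 := congrArg ι (div_mul_cancel₀ (-1) ha)
      simp only [map_mul, map_neg, map_one, map_zero] at e2 ⊢
      linear_combination l * e2
  · exact key a c hc

theorem two_step_eigenvalue [NeZero p] {F : Γ → ℝ} {μ : ℝ}
    (hμ : ∀ A, μ * F A = ∑ k : ZMod p, F (A * s ^ k.val * r)) (A : Γ) :
    μ ^ 2 * F A = ∑ k : ZMod p, ∑ j : ZMod p, F (A * s ^ k.val * r * s ^ j.val * r) := by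
  rw [pow_two, mul_assoc, hμ, Finset.mul_sum]
  exact Finset.sum_congr rfl fun k _ => hμ _

/-- The eigenvalues of the walk operator on functions that depend only on the first column up to
sign. -/
theorem sq_eigenvalue [Fact p.Prime] (hl : l * l = ι m)
    (hind : ∀ x y, ι x + ι y * l = 0 → x = 0 ∧ y = 0) (hr : β r = weyl Q) (hs : β s = upper l)
    (hβ : ∀ A, HasParity ι l (β A : Matrix (Fin 2) (Fin 2) Q)) {F : Γ → ℝ}
    (hF : ∀ A B, (∀ i, β A i 0 = β B i 0) ∨ (∀ i, β A i 0 = -β B i 0) → F A = F B) {μ : ℝ}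
    (hμ : ∀ A, μ * F A = ∑ k : ZMod p, F (A * s ^ k.val * r)) (h1 : F 1 ≠ 0) :
    μ ^ 2 = p ^ 2 ∨ μ ^ 2 = p ∨ μ ^ 2 = 1 ∨ μ ^ 2 = 0 := by
  have hμ2 := two_step_eigenvalue hμ
  have eqF : ∀ A B, β A 0 0 = β B 0 0 → β A 1 0 = β B 1 0 → F A = F B := fun A B h0 h1 =>
    hF A B (Or.inl (Fin.forall_fin_two.2 ⟨h0, h1⟩))
  have eqF' : ∀ A B, β A 0 0 = -β B 0 0 → β A 1 0 = -β B 1 0 → F A = F B := fun A B h0 h1 =>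
    hF A B (Or.inr (Fin.forall_fin_two.2 ⟨h0, h1⟩))
  have hinj : ∀ x, ι x = 0 → x = 0 := fun x hx => (hind x 0 (by simp [hx])).1
  by_cases hm : m = 0
  -- Here `l² = 0`. The columns `(1, j l)` are permuted up to sign by two steps, `i` going to `i -
  -- j` whatever `k` is, so `μ²` acts as `p` times the sum over all of them.
  · subst hm
    rw [map_zero] at hl
    let T : ZMod p → Γ := fun j => r * s ^ (-j).val * r⁻¹ * 1
    have T0 : ∀ j, β (T j) 0 0 = 1 := fun j => by
      rw [(lower_apply (ι := ι) hr hs _ _).1]; simp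
    have T1 : ∀ j, β (T j) 1 0 = ι j * l := fun j => by
      rw [(lower_apply (ι := ι) hr hs _ _).2]; simp
    have hdet : ∀ j, β (T j) 1 1 = 1 + ι j * l * β (T j) 0 1 := fun j => by
      have := (β (T j)).det_coe
      rw [det_fin_two, T0, T1] at this
      linear_combination this
    have hT01 : ∀ j, β (T j) 0 1 = 0 := fun j => by
      simp [T, hr, hs, upper_pow, coe_mul, coe_inv, coe_upper, coe_weyl, mul_apply,
        Fin.sum_univ_two, adjugate_fin_two]
    set P := ∑ j, F (T j) with hP
    have e : ∀ i, μ ^ 2 * F (T i) = p * P := by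
      intro i
      have hk : ∀ k : ZMod p, ∑ j : ZMod p, F (T i * s ^ k.val * r * s ^ j.val * r) = P := by
        intro k
        refine Fintype.sum_equiv (Equiv.subLeft i) _ _ fun j => eqF' _ _ ?_ ?_
        · rw [map_two_step (ι := ι) hr hs, hl, T0, T0, hT01]; ring
        · rw [map_two_step (ι := ι) hr hs, hl, T1, T1, hdet, hT01, Equiv.subLeft_apply, map_sub]
          ring
      rw [hμ2, Finset.sum_congr rfl fun k _ => hk k, Finset.sum_const, Finset.card_univ,
        ZMod.card, nsmul_eq_mul]
    have eP : μ ^ 2 * P = p ^ 2 * P := by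
      conv_lhs => rw [hP, Finset.mul_sum, Finset.sum_congr rfl fun i _ => e i]
      rw [Finset.sum_const, Finset.card_univ, ZMod.card, nsmul_eq_mul]
      ring
    by_cases hP0 : P = 0
    · right; right; right
      have h2 := e 0
      rw [hP0, mul_zero, eqF (T 0) 1 (by rw [T0]; simp) (by rw [T1]; simp)] at h2
      exact (mul_eq_zero.1 h2).resolve_right h1
    · exact Or.inl (mul_right_cancel₀ hP0 eP)
  · choose! T T0 T1 using exists_col_eq (β := β) hl hm hr hs
    -- The origin is not a column of an invertible matrix; the value `0` there makes it harmless in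
    -- the sums over lines and the plane.
    let g : ZMod p → ZMod p → ℝ := fun a c => if a ≠ 0 ∨ c ≠ 0 then F (T a c) else 0
    have hg : ∀ a c, (a ≠ 0 ∨ c ≠ 0) → g a c = F (T a c) := fun a c h => if_pos h
    have g_zero : g 0 0 = 0 := by simp [g]
    have g_neg : ∀ a c, g (-a) (-c) = g a c := by
      intro a c
      by_cases h : a ≠ 0 ∨ c ≠ 0
      · have h' : -a ≠ 0 ∨ -c ≠ 0 := by simpa using h
        rw [hg _ _ h, hg _ _ h']
        exact eqF' _ _ (by rw [T0 _ _ h, T0 _ _ h', map_neg])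
          (by rw [T1 _ _ h, T1 _ _ h', map_neg, neg_mul])
      · have h' : ¬(-a ≠ 0 ∨ -c ≠ 0) := by simpa using h
        simp only [g, if_neg h, if_neg h']
    have F_eq : ∀ A a c, β A 0 0 = ι a → β A 1 0 = ι c * l → F A = g a c := by
      intro A a c h0 h1
      have h : a ≠ 0 ∨ c ≠ 0 := by
        by_contra! H
        have := (β A).det_coe
        rw [det_fin_two, h0, h1, H.1, H.2] at this
        have h01 : ι 1 = 0 := by
          rw [map_one, ← this]; simp
        exact one_ne_zero (hinj 1 h01)
      rw [hg _ _ h]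
      exact eqF _ _ (by rw [T0 _ _ h, h0]) (by rw [T1 _ _ h, h1])
    have step : ∀ a c, (a ≠ 0 ∨ c ≠ 0) →
        μ ^ 2 * g a c = p * g a c + (∑ a, ∑ b, g a b) - ∑ t, g (t * a) (t * c) := by
      -- The first column fixes the parity type of `T a c`, since `1` and `l` are independent; hence
      -- its second column is `(x l, y)`.
      intro a c hac
      obtain ⟨x, y, hx, hy⟩ : ∃ x y, β (T a c) 0 1 = ι x * l ∧ β (T a c) 1 1 = ι y := by
        rcases hβ (T a c) with ⟨a', b', c', d', h⟩ | ⟨a', b', c', d', h⟩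
        · exact ⟨b', d', by rw [h]; simp, by rw [h]; simp⟩
        · exfalso
          have h0 := T0 a c hac
          have h1 := T1 a c hac
          rw [h] at h0 h1
          simp at h0 h1
          have h0' := (hind a (-a') (by rw [map_neg, ← h0]; ring)).1
          have h1' := (hind (-c') c (by rw [map_neg, h1]; ring)).2
          exact hac.elim (· h0') (· h1')
      have hdet : a * y - m * x * c = 1 := by
        have := (β (T a c)).det_coe
        rw [det_fin_two, T0 a c hac, T1 a c hac, hx, hy] at this
        refine sub_eq_zero.1 (hinj _ ?_)
        simp only [map_sub, map_mul, map_one]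
        linear_combination this + ι x * ι c * hl
      rw [← sum_two_step g g_neg hm hdet, hg a c hac, hμ2]
      refine Finset.sum_congr rfl fun k _ => Finset.sum_congr rfl fun j _ => F_eq _ _ _ ?_ ?_
      · rw [map_two_step (ι := ι) hr hs, T0 a c hac, hx]
        simp only [map_add, map_sub, map_mul, map_one, ← hl]
        ring
      · rw [map_two_step (ι := ι) hr hs, T1 a c hac, hy]
        simp only [map_add, map_sub, map_mul, map_one, ← hl]
        ring
    have hne : g 1 0 ≠ 0 := by
      rwa [← F_eq 1 1 0 (by simp) (by simp)]
    rcases sq_eq_of_plane_eigenfunction g (μ ^ 2) g_zero step hne with h | h | h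
    exacts [Or.inl h, Or.inr (Or.inl h), Or.inr (Or.inr (Or.inl h))]

/-- A regular map covered by a group of matrices over the residue ring, generated by `(0, -1; 1, 0)`
and `(1, l; 0, 1)`, with matrices identified up to sign, has a Ramanujan underlying graph. -/
theorem isRamanujan_of_hom [Finite Q] [Fact p.Prime] (hl : l * l = ι m)
    (hind : ∀ x y, ι x + ι y * l = 0 → x = 0 ∧ y = 0) (M : RegularMap) (α : Γ →* M.G)
    (hα : Function.Surjective α) (hαβ : ∀ A, α A = 1 ↔ β A = 1 ∨ β A = -1)
    (hβ : ∀ A, β A ∈ Subgroup.closure {weyl Q, upper l})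
    (hr : β r = weyl Q) (hs : β s = upper l) (hαr : α r = M.x * M.y) (hαs : α s = M.y) :
    IsRamanujan M.graph p := by
  have hinj : ∀ x, ι x = 0 → x = 0 := fun x hx => (hind x 0 (by simp [hx])).1
  have hpar : ∀ A, HasParity ι l (β A : Matrix (Fin 2) (Fin 2) Q) := fun A =>
    hasParity_of_mem hl (hβ A)
  have hQ1 : (1 : Q) ≠ 0 := fun h => one_ne_zero (hinj 1 (by rw [map_one, h]))
  have hαeq : ∀ A B, α A = α B ↔ β A = β B ∨ β A = -β B := by
    intro A B
    rw [← inv_mul_eq_one, ← map_inv, ← map_mul, hαβ, map_mul, map_inv, inv_mul_eq_one,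
      inv_mul_eq_iff_eq_mul]
    refine or_congr_right ?_
    rw [mul_neg, mul_one]
    exact ⟨fun h => by rw [h, neg_neg], fun h => by rw [h, neg_neg]⟩
  have hp0 : (p : Q) = 0 := by rw [← map_natCast ι, ZMod.natCast_self, map_zero]
  have hcast : ∀ n : ℤ, (n : Q) * l = 0 → (p : ℤ) ∣ n := fun n hn => by
    rw [← ZMod.intCast_zmod_eq_zero_iff_dvd]
    exact (hind 0 n (by rw [map_zero, zero_add, map_intCast, hn])).2
  have hy : M.y ^ p = 1 := by
    rw [← hαs, ← map_pow, hαβ, map_pow, hs, upper_pow, hp0, zero_mul]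
    left
    ext i j
    fin_cases i <;> fin_cases j <;> simp [coe_upper]
  have key : ∀ X Y : Matrix.SpecialLinearGroup (Fin 2) Q, X = Y ∨ X = -Y →
      X 1 0 = Y 1 0 ∨ X 1 0 = -Y 1 0 := by
    rintro X Y (h | h) <;> rw [h]
    · exact Or.inl rfl
    · right; simp
  -- No loops: the lower left entry is `1` in `weyl` and `0` in powers of `upper l`.
  have hW : M.x * M.y ∉ Subgroup.zpowers M.y := by
    rintro ⟨k, hk⟩
    simp only at hk
    rw [← hαr, ← hαs, ← map_zpow, hαeq, map_zpow, hr, hs, upper_zpow] at hk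
    have h := key _ _ hk
    simp [coe_upper, coe_weyl, eq_comm] at h
    exact hQ1 h.symm
  -- No multiple edges: the lower left entry of the product is `k l`.
  have hk : ∀ k : ℤ, (M.x * M.y) * M.y ^ k * (M.x * M.y) ∈ Subgroup.zpowers M.y →
      (p : ℤ) ∣ k := by
    rintro k ⟨j, hj⟩
    simp only at hj
    rw [← hαr, ← hαs, ← map_zpow, ← map_zpow, ← map_mul, ← map_mul, hαeq, map_zpow, map_mul,
      map_mul, map_zpow, hr, hs, upper_zpow, upper_zpow] at hj
    have h := key _ _ hj
    simp [coe_upper, coe_weyl, coe_mul, mul_apply, Fin.sum_univ_two] at h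
    refine hcast k ?_
    simpa [eq_comm] using h
  have hfin : Finite M.Vertex := by
    have hsurj : ∀ v : M.Vertex, ∃ A : Γ, ((α A : M.G) : M.Vertex) = v := by
      intro v
      obtain ⟨g, rfl⟩ := QuotientGroup.mk_surjective v
      obtain ⟨A, rfl⟩ := hα g
      exact ⟨A, rfl⟩
    choose A hA using hsurj
    refine Finite.of_injective (fun v => β (A v)) fun v w h => ?_
    rw [← hA v, ← hA w, (hαeq _ _).2 (Or.inl h)]
  let _ : Fintype M.Vertex := Fintype.ofFinite _
  refine ⟨M.connected, inferInstance, M.isRegularOfDegree hy hW hk, fun μ hμ hne => ?_⟩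
  refine abs_lt_two_sqrt_of_sq (Fact.out : p.Prime).two_le hne ?_
  obtain ⟨f, hf⟩ := hμ.exists_hasEigenvector
  have hfμ := hf.apply_eq_smul
  obtain ⟨v, hv⟩ := Function.ne_iff.1 hf.2
  obtain ⟨g, rfl⟩ := QuotientGroup.mk_surjective v
  obtain ⟨A₀, rfl⟩ := hα g
  -- Translating by `A₀` puts a vertex where `f` is nonzero at the identity, so only columns of the
  -- form `(a, c l)` need to be considered.
  refine sq_eigenvalue (F := fun A => f ((α (A₀ * A) : M.G) : M.Vertex)) hl hind hr hs hpar ?_ ?_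
    (by simpa using hv)
  · intro A B hAB
    have hmem : (α (A₀ * A))⁻¹ * α (A₀ * B) ∈ Subgroup.zpowers M.y := by
      rw [← map_inv, ← map_mul, mul_inv_rev, mul_assoc, inv_mul_cancel_left]
      have hC : ∃ ε : ZMod p, ε * ε = 1 ∧ β (A⁻¹ * B) 0 0 = ι ε ∧ β (A⁻¹ * B) 1 0 = 0 := by
        have hdet := (β A).det_coe
        rw [det_fin_two] at hdet
        have e0 : β (A⁻¹ * B) 0 0 = β A 1 1 * β B 0 0 - β A 0 1 * β B 1 0 := by
          simp [coe_mul, coe_inv, adjugate_fin_two, mul_apply, Fin.sum_univ_two]; ring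
        have e1 : β (A⁻¹ * B) 1 0 = - β A 1 0 * β B 0 0 + β A 0 0 * β B 1 0 := by
          simp [coe_mul, coe_inv, adjugate_fin_two, mul_apply, Fin.sum_univ_two]
        rcases hAB with h | h
        · refine ⟨1, by ring, ?_, ?_⟩
          · rw [e0, ← h, ← h, map_one]; linear_combination hdet
          · rw [e1, ← h, ← h]; ring
        · have h' : ∀ i, β B i 0 = - β A i 0 := fun i => by rw [h, neg_neg]
          refine ⟨-1, by ring, ?_, ?_⟩
          · rw [e0, h', h', map_neg, map_one]; linear_combination -hdet
          · rw [e1, h', h']; ring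
      obtain ⟨ε, hε, h0, h1⟩ := hC
      have hε0 : ε ≠ 0 := by rintro rfl; simp at hε
      have hC := hpar (A⁻¹ * B)
      have hdet := (β (A⁻¹ * B)).det_coe
      rw [det_fin_two, h0, h1, mul_zero, sub_zero] at hdet
      have hεQ : ι ε * ι ε = 1 := by rw [← map_mul, hε, map_one]
      have h11 : β (A⁻¹ * B) 1 1 = ι ε := by
        linear_combination ι ε * hdet - β (A⁻¹ * B) 1 1 * hεQ
      -- Parity is essential here: powers of `upper l` have only multiples of `l` by the prime field
      -- in this corner.
      obtain ⟨b, hb⟩ : ∃ b, β (A⁻¹ * B) 0 1 = ι b * l := by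
        rcases hC with ⟨a, b, c, d, h⟩ | ⟨a, b, c, d, h⟩
        · exact ⟨b, by rw [h]; simp⟩
        · exfalso
          rw [h] at h0
          simp at h0
          exact hε0 (hind ε (-a) (by rw [map_neg, ← h0]; ring)).1
      -- The matrix `(ε, b l; 0, ε)` with `ε = ±1` is `ε` times `upper (ε b l)`.
      refine ⟨((ε * b).val : ℤ), ?_⟩
      simp only [zpow_natCast]
      rw [← hαs, ← map_pow, hαeq, map_pow, hs, upper_pow]
      have hval : (((ε * b).val : ℕ) : Q) = ι ε * ι b := by
        rw [natCast_val_eq ι, map_mul]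
      rw [hval]
      rcases mul_self_eq_one_iff.1 hε with rfl | rfl
      · left
        ext i j
        fin_cases i <;> fin_cases j
        · simp [coe_upper]; simpa using h0.symm
        · simp [coe_upper]; simpa using hb.symm
        · simp [coe_upper]; simpa using h1.symm
        · simp [coe_upper]; simpa using h11.symm
      · right
        ext i j
        fin_cases i <;> fin_cases j
        · simp [coe_upper]; simp at h0; simp [h0]
        · simp [coe_upper]; simp at hb; simp [hb]
        · simp [coe_upper]; simp at h1; simp [h1]
        · simp [coe_upper]; simp at h11; simp [h11]
    exact congrArg f (QuotientGroup.eq.2 hmem)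
  · classical
    intro A
    have h : (M.graph.adjMatrix ℝ).mulVec f ((α (A₀ * A) : M.G) : M.Vertex)
        = (μ • f) ((α (A₀ * A) : M.G) : M.Vertex) := congrFun hfμ _
    rw [RegularMap.adjMatrix_mulVec_apply hy hW hk, Pi.smul_apply,
      smul_eq_mul] at h
    rw [← h]
    refine Finset.sum_congr rfl fun k _ => ?_
    have e : α (A₀ * A) * M.y ^ k.val * (M.x * M.y) = α (A₀ * (A * s ^ k.val * r)) := by
      rw [← hαr, ← hαs]
      simp only [map_mul, map_pow, mul_assoc]
    rw [RegularMap.neighbor, e]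

end Residue

/-! ### Hecke groups with `λ_q` a quadratic irrationality -/

section Quadratic

variable {q m : ℕ}

theorem exists_eq_add_mul_lam (hsq : lam q ^ 2 = m) (x : HeckeRing q) :
    ∃ a b : ℤ, (x : ℝ) = a + b * lam q := by
  obtain ⟨x, hx⟩ := x
  simp only
  induction hx using Algebra.adjoin_induction with
  | mem x hx => exact ⟨0, 1, by simp [Set.mem_singleton_iff.1 hx]⟩
  | algebraMap n => exact ⟨n, 0, by simp⟩
  | add x y _ _ hx hy =>
    obtain ⟨a, b, rfl⟩ := hx
    obtain ⟨c, d, rfl⟩ := hy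
    exact ⟨a + c, b + d, by push_cast; ring⟩
  | mul x y _ _ hx hy =>
    obtain ⟨a, b, rfl⟩ := hx
    obtain ⟨c, d, rfl⟩ := hy
    exact ⟨a * c + m * b * d, a * d + b * c, by push_cast; rw [← hsq]; ring⟩

theorem eq_zero_of_add_mul_lam_eq_zero (hirr : Irrational (lam q)) {a b : ℤ}
    (h : (a : ℝ) + b * lam q = 0) : a = 0 ∧ b = 0 := by
  have hb : b = 0 := by
    by_contra hb
    refine (hirr.intCast_mul hb).ne_int (-a) ?_
    push_cast
    linarith
  subst hb
  simpa using h

/-- The residue ring `ℤ[λ_q] / (p)`. -/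
abbrev Residue (q p : ℕ) : Type := HeckeRing q ⧸ Ideal.span {(p : HeckeRing q)}

variable (q) in
/-- The class of `λ_q` modulo `p`. -/
noncomputable def lamResidue (p : ℕ) : Residue q p := Ideal.Quotient.mk _ (lamInt q)

theorem lamResidue_mul_self (hsq : lam q ^ 2 = m) (p : ℕ) :
    lamResidue q p * lamResidue q p = m := by
  have h : lamInt q * lamInt q = (m : HeckeRing q) := by
    apply Subtype.ext
    push_cast
    rw [← hsq, pow_two]
    rfl
  rw [lamResidue, ← map_mul, h, map_natCast]

theorem natCast_residue_eq_zero (q p : ℕ) : (p : Residue q p) = 0 := by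
  have h : Ideal.Quotient.mk (Ideal.span {(p : HeckeRing q)}) (p : HeckeRing q) = 0 :=
    Ideal.Quotient.eq_zero_iff_mem.2 (Ideal.mem_span_singleton_self _)
  rwa [map_natCast] at h

/-- Write `a + b λ = p (c + d λ)` and compare coefficients. This makes `1` and `λ` independent over
the prime field even when the residue ring is not a field. -/
theorem dvd_of_residue_eq_zero (hsq : lam q ^ 2 = m) (hirr : Irrational (lam q)) {p : ℕ} {a b : ℤ}
    (h : (a : Residue q p) + b * lamResidue q p = 0) : (p : ℤ) ∣ a ∧ (p : ℤ) ∣ b := by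
  have h' : Ideal.Quotient.mk (Ideal.span {(p : HeckeRing q)}) ((a : HeckeRing q) + b * lamInt q)
      = 0 := by
    rw [map_add, map_mul, map_intCast, map_intCast]
    exact h
  obtain ⟨x, hx⟩ := Ideal.mem_span_singleton'.1 (Ideal.Quotient.eq_zero_iff_mem.1 h')
  obtain ⟨c, d, hcd⟩ := exists_eq_add_mul_lam hsq x
  have hx' := congrArg (Subtype.val : HeckeRing q → ℝ) hx
  push_cast at hx'
  rw [hcd] at hx'
  have hlam : ((lamInt q : HeckeRing q) : ℝ) = lam q := rfl
  rw [hlam] at hx'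
  have h0 := eq_zero_of_add_mul_lam_eq_zero hirr (a := a - p * c) (b := b - p * d) (by
    push_cast; linear_combination -hx')
  exact ⟨⟨c, sub_eq_zero.1 h0.1⟩, ⟨d, sub_eq_zero.1 h0.2⟩⟩

theorem charP_residue (hsq : lam q ^ 2 = m) (hirr : Irrational (lam q)) (p : ℕ) :
    CharP (Residue q p) p := by
  refine ⟨fun n => ⟨fun h => ?_, fun ⟨k, hk⟩ => ?_⟩⟩
  · exact Int.natCast_dvd_natCast.1
      (dvd_of_residue_eq_zero hsq hirr (a := n) (b := 0) (by simpa using h)).1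
  · rw [hk, Nat.cast_mul, natCast_residue_eq_zero, zero_mul]

theorem finite_residue (hsq : lam q ^ 2 = m) (hirr : Irrational (lam q)) (p : ℕ) [NeZero p] :
    Finite (Residue q p) := by
  have := charP_residue hsq hirr p
  refine Finite.of_surjective (fun z : ZMod p × ZMod p =>
    ZMod.castHom (dvd_refl p) (Residue q p) z.1 +
      ZMod.castHom (dvd_refl p) (Residue q p) z.2 * lamResidue q p) fun x => ?_
  obtain ⟨x, rfl⟩ := Ideal.Quotient.mk_surjective x
  obtain ⟨a, b, h⟩ := exists_eq_add_mul_lam hsq x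
  have hx : x = a + b * lamInt q := by
    apply Subtype.ext
    rw [h]
    push_cast
    rfl
  refine ⟨(a, b), ?_⟩
  simp only [map_intCast]
  rw [hx, map_add, map_mul, map_intCast, map_intCast]
  rfl

end Quadratic

/-! ### Matrices over `ℤ[λ_q]` as a cover of the darts of the Hecke map. -/

section Cover

variable (q p : ℕ)

/-- The subgroup of `SL₂(ℤ[λ_q])` generated by the matrices `R` and `S`. -/
noncomputable def heckeSL : Subgroup (Matrix.SpecialLinearGroup (Fin 2) (HeckeRing q)) :=
  Subgroup.closure {matR q, matS q}

theorem map_toPSL_heckeSL : (heckeSL q).map (toPSL q) = heckeGroup q := by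
  rw [heckeSL, MonoidHom.map_closure, Set.image_pair]
  rfl

/-- The projection from matrices to the Hecke group. -/
noncomputable def heckeSLToHecke : heckeSL q →* heckeGroup q :=
  ((toPSL q).comp (heckeSL q).subtype).codRestrict (heckeGroup q) fun A => by
    rw [← map_toPSL_heckeSL]
    exact Subgroup.mem_map_of_mem _ A.2

/-- The projection from matrices to the darts of the Hecke map. -/
noncomputable def toDart : heckeSL q →* (heckeMap q p).G :=
  (QuotientGroup.mk' (heckeCongruence q p)).comp (heckeSLToHecke q)

/-- Reduction of matrices modulo `p`. -/
noncomputable def reduction :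
    Matrix.SpecialLinearGroup (Fin 2) (HeckeRing q) →*
      Matrix.SpecialLinearGroup (Fin 2) (Residue q p) :=
  Matrix.SpecialLinearGroup.map (n := Fin 2)
    (Ideal.Quotient.mk (Ideal.span {(p : HeckeRing q)}))

theorem toDart_surjective : Function.Surjective (toDart q p) := by
  intro x
  obtain ⟨⟨h, hh⟩, rfl⟩ := QuotientGroup.mk'_surjective (heckeCongruence q p) x
  have hh' := hh
  rw [← map_toPSL_heckeSL] at hh'
  obtain ⟨A, hA, rfl⟩ := hh'
  exact ⟨⟨A, hA⟩, rfl⟩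

theorem toPSL_eq_one_iff (A : Matrix.SpecialLinearGroup (Fin 2) (HeckeRing q)) :
    toPSL q A = 1 ↔ A = 1 ∨ A = -1 := by
  rw [toPSL, QuotientGroup.mk'_apply, QuotientGroup.eq_one_iff,
    Matrix.SpecialLinearGroup.mem_center_iff]
  constructor
  · rintro ⟨c, hc, h⟩
    rw [Fintype.card_fin, sq_eq_one_iff] at hc
    rcases hc with rfl | rfl
    · left
      apply Subtype.ext
      rw [← h, map_one]
      rfl
    · right
      apply Subtype.ext
      rw [← h, map_neg, map_one]
      rfl
  · rintro (rfl | rfl)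
    · exact ⟨1, by simp, by simp⟩
    · exact ⟨-1, by simp, by rw [map_neg, map_one]; rfl⟩

/-- The sign ambiguity of `PSL₂` survives reduction modulo `p`: a class is congruent to the identity
when one of its two representatives `±A` is. Darts are thus reduced matrices up to sign. -/
theorem toDart_eq_one_iff (A : heckeSL q) :
    toDart q p A = 1 ↔
      reduction q p (A : Matrix.SpecialLinearGroup (Fin 2) (HeckeRing q)) = 1 ∨
        reduction q p (A : Matrix.SpecialLinearGroup (Fin 2) (HeckeRing q)) = -1 := by
  have hneg : ∀ B : Matrix.SpecialLinearGroup (Fin 2) (HeckeRing q),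
      reduction q p (-B) = -reduction q p B := by
    intro B
    ext i j
    simp [reduction]
  have h1 : toDart q p A = 1 ↔ toPSL q (A : Matrix.SpecialLinearGroup (Fin 2) (HeckeRing q)) ∈
      congruencePSL q p := by
    refine (QuotientGroup.eq_one_iff (N := heckeCongruence q p) (heckeSLToHecke q A)).trans ?_
    exact Subgroup.mem_subgroupOf
  rw [h1]
  constructor
  · rintro ⟨B, hB, hBA⟩
    have hB1 : reduction q p B = 1 := hB
    have h2 : toPSL q (B⁻¹ * A) = 1 := by rw [map_mul, map_inv, hBA, inv_mul_cancel]
    rcases (toPSL_eq_one_iff q _).1 h2 with h | h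
    · left
      rw [inv_mul_eq_one] at h
      rw [← h, hB1]
    · right
      rw [inv_mul_eq_iff_eq_mul, mul_neg, mul_one] at h
      rw [h, hneg, hB1]
  · rintro (h | h)
    · exact ⟨A, h, rfl⟩
    · refine ⟨-A, ?_, ?_⟩
      · change reduction q p _ = 1
        rw [hneg, h, neg_neg]
      · have h2 : toPSL q (-1) = 1 := (toPSL_eq_one_iff q _).2 (Or.inr rfl)
        rw [← neg_one_mul, map_mul, h2, one_mul]

theorem reduction_matR : reduction q p (matR q) = weyl (Residue q p) := by
  ext i j
  change Ideal.Quotient.mk _ (!![0, -1; 1, 0] i j) = _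
  fin_cases i <;> fin_cases j
  exacts [map_zero _, (map_neg _ _).trans (congrArg _ (map_one _)), map_one _, map_zero _]

theorem reduction_matS : reduction q p (matS q) = upper (lamResidue q p) := by
  ext i j
  change Ideal.Quotient.mk _ (!![1, lamInt q; 0, 1] i j) = _
  fin_cases i <;> fin_cases j
  exacts [map_one _, rfl, map_zero _, map_one _]

theorem reduction_mem_closure (A : heckeSL q) :
    reduction q p (A : Matrix.SpecialLinearGroup (Fin 2) (HeckeRing q)) ∈
      Subgroup.closure {weyl (Residue q p), upper (lamResidue q p)} := by
  rw [← reduction_matR, ← reduction_matS, ← Set.image_pair, ← MonoidHom.map_closure]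
  exact Subgroup.mem_map_of_mem _ A.2

end Cover

/-- If `λ_q` is the square root of an integer and irrational, then the underlying graph of the
Hecke map `M_q(p)` is a Ramanujan graph of degree `p` for every prime `p`. -/
theorem isRamanujan_heckeMap {q m p : ℕ} (hsq : lam q ^ 2 = m) (hirr : Irrational (lam q))
    (hp : p.Prime) : IsRamanujan (heckeMap q p).graph p := by
  have : Fact p.Prime := ⟨hp⟩
  have := charP_residue hsq hirr p
  have := finite_residue hsq hirr p
  refine isRamanujan_of_hom (ι := ZMod.castHom (dvd_refl p) (Residue q p)) (l := lamResidue q p)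
    (m := (m : ZMod p)) (β := (reduction q p).comp (heckeSL q).subtype)
    (r := ⟨matR q, Subgroup.subset_closure (by simp)⟩)
    (s := ⟨matS q, Subgroup.subset_closure (by simp)⟩) ?_ ?_ (heckeMap q p) (toDart q p)
    (toDart_surjective q p) (toDart_eq_one_iff q p) (reduction_mem_closure q p)
    (reduction_matR q p) (reduction_matS q p) ?_ rfl
  · rw [lamResidue_mul_self hsq, map_natCast]
  · intro x y h
    obtain ⟨a, rfl⟩ := ZMod.intCast_surjective x
    obtain ⟨b, rfl⟩ := ZMod.intCast_surjective y
    rw [map_intCast, map_intCast] at h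
    rw [ZMod.intCast_zmod_eq_zero_iff_dvd, ZMod.intCast_zmod_eq_zero_iff_dvd]
    exact dvd_of_residue_eq_zero hsq hirr h
  · change ((heckeR q : heckeGroup q) : heckeGroup q ⧸ heckeCongruence q p) =
      ((heckeR q * (heckeS q)⁻¹ * heckeS q : heckeGroup q) : heckeGroup q ⧸ heckeCongruence q p)
    rw [inv_mul_cancel_right]

theorem lam_four : lam 4 = Real.sqrt 2 := by
  rw [lam, Nat.cast_ofNat, Real.cos_pi_div_four]
  ring

theorem lam_six : lam 6 = Real.sqrt 3 := by
  rw [lam, Nat.cast_ofNat, Real.cos_pi_div_six]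
  ring

end HeckeMaps

theorem mainTheorem10 (p : ℕ) (hp : p.Prime) :
    HeckeMaps.IsRamanujan (HeckeMaps.heckeMap 4 p).graph p ∧
      HeckeMaps.IsRamanujan (HeckeMaps.heckeMap 6 p).graph p := by
  constructor
  · refine HeckeMaps.isRamanujan_heckeMap (m := 2) ?_ ?_ hp <;> rw [HeckeMaps.lam_four]
    · simp
    · exact irrational_sqrt_two
  · refine HeckeMaps.isRamanujan_heckeMap (m := 3) ?_ ?_ hp <;> rw [HeckeMaps.lam_six]
    · simp
    · exact_mod_cast Nat.prime_three.irrational_sqrt
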